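/- Let $\gamma>8$, $C_0\ge 4$ and $q\in[0,2)$. There exist constants $C_1,C_2>0$, depending only on $\gamma$, $C_0$ and $q$, such that the following holds for all integers $n,p\ge 1$ and all $R>0$ for which $\gamma\log p<n$ and $$\tau:=2C_0\sqrt{\frac{\gamma\log p}{n}}\le 1 .$$ Let $\Sigma=(\sigma_{ij})$ be any $p\times p$ real symmetric positive semidefinite matrix with $\sigma_{ii}=1$ for all $i$ and $\sum_{i\ne j}|\sigma_{ij}|^q\le R$ (sum over ordered pairs, with the convention $0^0=0$, so that for $q=0$ the sum is the number of nonzero off-diagonal entries); that is, $\Sigma\in\mathcal F_q(R)$. Let $X_1,\dots,X_n$ be i.i.d. $\mathcal N(0,\Sigma)$ random vectors in $\mathbb R^p$ and let $\hat\Sigma=(\hat\sigma_{ij})=\frac1n\sum_{k=1}^nX_kX_k^\top$. Let $\tilde\Sigma_\tau$ have entries $\tilde\sigma_{ij}=\hat\sigma_{ij}\mathbf 1\{|\hat\sigma_{ij}|>\tau\}$ for $i\ne j$ and $\tilde\sigma_{ii}=\hat\sigma_{ii}$, and for a matrix $A=(a_{ij})$ put $Q(A)=\sum_{i\neq j}a_{ij}^2$.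 Then $$\mathbb E\Big[\big(Q(\tilde\Sigma_\tau)-Q(\Sigma)\big)^2\Big]\le C_1\max\Big\{\frac{R^2}{n},\;R^2\Big(\frac{\log p}{n}\Big)^{2-q}\Big\}+C_2\,p^{4-\gamma/2},$$ and in particular the expectation is finite. -/

import Mathlib

namespace SparseQuad

open MeasureTheory ProbabilityTheory

noncomputable section

/-- The quadratic functional `Q(A) = ∑_{i ≠ j} a_ij ^ 2` (sum over ordered pairs). -/
def offDiagQuad {p : ℕ} (A : Matrix (Fin p) (Fin p) ℝ) : ℝ :=
  ∑ i, ∑ j, if i ≠ j then A i j ^ 2 else 0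

/-- `|x| ^ q`, with the convention `|0| ^ 0 = 0`, so that for `q = 0` it is the indicator
of `x ≠ 0`.  For `q > 0` this is the usual power. -/
def absPow (q x : ℝ) : ℝ :=
  if x = 0 then 0 else |x| ^ q

/-- The class `F_q(R)` of sparse `p × p` correlation matrices. -/
def sparseCorrClass (p : ℕ) (q R : ℝ) : Set (Matrix (Fin p) (Fin p) ℝ) :=
  {S | S.PosSemidef ∧ (∀ i, S i i = 1) ∧
    ∑ i, ∑ j, (if i ≠ j then absPow q (S i j) else 0) ≤ R}

/-- The empirical covariance matrix `n⁻¹ ∑_k x_k x_kᵀ` of the sample `x_1, …, x_n`. -/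
def empCov {n p : ℕ} (x : Fin n → EuclideanSpace ℝ (Fin p)) : Matrix (Fin p) (Fin p) ℝ :=
  (n : ℝ)⁻¹ • ∑ k, Matrix.vecMulVec (x k) (x k)

open Classical in
/-- Hard thresholding at level `τ` of the off-diagonal entries; the diagonal is kept. -/
def hardThreshold {p : ℕ} (τ : ℝ) (A : Matrix (Fin p) (Fin p) ℝ) : Matrix (Fin p) (Fin p) ℝ :=
  Matrix.of fun i j => if i = j then A i j else if τ < |A i j| then A i j else 0

/-- The plug-in estimator `Q(Σ̃_τ)` computed from the sample `x_1, …, x_n`. -/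
def quadEstimator {n p : ℕ} (τ : ℝ) (x : Fin n → EuclideanSpace ℝ (Fin p)) : ℝ :=
  offDiagQuad (hardThreshold τ (empCov x))

/-- The threshold `τ = 2 C₀ √(γ log p / n)`. -/
def threshold (C₀ γ : ℝ) (n p : ℕ) : ℝ :=
  2 * C₀ * √(γ * Real.log p / n)

/-- The rate `ψ_{n,p}(q,R) = R² / n ∨ R² (log p / n) ^ (2 - q)`. -/
def rate (n p : ℕ) (q R : ℝ) : ℝ :=
  max (R ^ 2 / n) (R ^ 2 * (Real.log p / n) ^ (2 - q))

/-- `X_1, …, X_n` are i.i.d. with law `N(0, S)`. -/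
def IsGaussianSample {Ω : Type*} [MeasurableSpace Ω] (P : Measure Ω) {n p : ℕ}
    (S : Matrix (Fin p) (Fin p) ℝ) (X : Fin n → Ω → EuclideanSpace ℝ (Fin p)) : Prop :=
  iIndepFun X P ∧ ∀ k, HasLaw (X k) (multivariateGaussian 0 S) P

end

end SparseQuad

/-!
Write `σ` for an off-diagonal entry `S i j`, `σ'` for the same entry of the empirical covariance
matrix, and `τ` for the threshold. The squared error is controlled on and off the event that
`|σ' - σ| ≤ τ / 2` for all off-diagonal entries.

On this event a thresholded entry satisfies, up to an error `9 |σ| ^ q τ ^ (2 - q)`, that its square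
is `σ ^ 2` plus the linear term `2 σ (σ' - σ)`, and the linear term is present only when
`2 τ < |σ|` (`abs_threshold_sq_sub_le`). Summing the errors over the sparsity class gives
`9 R τ ^ (2 - q)`, whose square is of order `R ^ 2 (log p / n) ^ (2 - q)`. The sum of the linear
terms is bounded in mean square by Cauchy–Schwarz and `E (σ' - σ) ^ 2 ≤ C / n`, so it contributes
`(∑ |σ|) ^ 2 / n`, the sum being over `2 τ < |σ| ≤ 1`. There `|σ| ≤ |σ| ^ q max 1 (τ ^ (1 - q))`
(`abs_le_absPow_mul_max`), which gives `R ^ 2 / n` or, when `1 < q`, a quantity of order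
`R ^ 2 τ ^ (2 - 2 q) / n ≤ R ^ 2 τ ^ (4 - 2 q)` (`max_sq_div_le`).

The complementary event has probability at most `2 p ^ (-γ)`. This comes from Chernoff's method:
by polarization `x y = ((x + y) ^ 2 - (x - y) ^ 2) / 4` and the explicit exponential moments of a
squared Gaussian, a centred product of two coordinates has moment generating function at most
`exp (3 l ^ 2)` for `|l| ≤ 1 / 12` (`integral_exp_mul_prod_sub_le`), hence a tail
`2 exp (- n t ^ 2 / 12)` at `t = τ / 2` for each entry
(`IsGaussianSample.measureReal_le_abs_empCov_sub_le`). Since the fourth moment of the error is at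
most of order `p ^ 8`, this event contributes `p ^ 4 p ^ (-γ / 2)`.
-/

namespace SparseQuad

open MeasureTheory ProbabilityTheory
open scoped NNReal

/-! ### Exponential moments of Gaussian products -/

/-- A second-order bound with explicit constant for the function `(1 - w) ^ (-1 / 2)`, which is the
moment generating function of a squared standard normal at `w / 2`. -/
lemma inv_sqrt_one_sub_le_exp {w : ℝ} (hw : |w| ≤ 1 / 3) :
    (√(1 - w))⁻¹ ≤ Real.exp (w / 2 + 3 / 8 * w ^ 2) := by
  obtain ⟨h1, h2⟩ := abs_le.1 hw
  -- For `0 ≤ w` a quadratic lower bound for `exp` suffices; for `w ≤ 0` the logarithm is compared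
  -- with `2 a / (a + 2)` at `a = -w`.
  have key : 1 ≤ (1 - w) * Real.exp (w + 3 / 4 * w ^ 2) := by
    rcases le_total 0 w with h0 | h0
    · have := Real.quadratic_le_exp_of_nonneg (x := w + 3 / 4 * w ^ 2) (by positivity)
      refine le_trans ?_ (mul_le_mul_of_nonneg_left this (by linarith))
      have h3 : 0 ≤ w ^ 2 * (1 / 3 - w) := mul_nonneg (sq_nonneg w) (by linarith)
      nlinarith [mul_nonneg (sq_nonneg w) h0, mul_nonneg h3 h0, mul_nonneg (mul_nonneg h3 h0) h0]
    · have h3 := Real.le_log_one_add_of_nonneg (x := -w) (by linarith)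
      have h4 : -(w + 3 / 4 * w ^ 2) ≤ 2 * (-w) / (-w + 2) := by
        rw [le_div_iff₀ (by linarith)]
        nlinarith [sq_nonneg w, mul_nonneg (sq_nonneg w) (neg_nonneg.2 h0)]
      have h5 : Real.exp (-(w + 3 / 4 * w ^ 2)) ≤ 1 + -w := by
        rw [← Real.le_log_iff_exp_le (by linarith)]
        exact h4.trans h3
      rw [Real.exp_neg, inv_le_iff_one_le_mul₀ (Real.exp_pos _)] at h5
      linarith
  have hpos : 0 < √(1 - w) := Real.sqrt_pos.2 (by linarith)
  rw [inv_le_iff_one_le_mul₀ hpos]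
  have : Real.exp (w + 3 / 4 * w ^ 2) = Real.exp (w / 2 + 3 / 8 * w ^ 2) ^ 2 := by
    rw [← Real.exp_nat_mul]; congr 1; push_cast; ring
  rw [this] at key
  have h6 : (1 - w) = √(1 - w) ^ 2 := (Real.sq_sqrt (by linarith)).symm
  rw [h6, ← mul_pow] at key
  have := (one_le_sq_iff₀ (by positivity)).1 key
  linarith

/-- Exponential moments of the square of a centred normal variable, whose variance may vanish. -/
lemma integrable_exp_mul_sq_gaussianReal {v : ℝ≥0} {s : ℝ} (hs : 2 * s * v < 1) :
    Integrable (fun x ↦ Real.exp (s * x ^ 2)) (gaussianReal 0 v) ∧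
      ∫ x, Real.exp (s * x ^ 2) ∂gaussianReal 0 v = (√(1 - 2 * s * v))⁻¹ := by
  rcases eq_or_ne v 0 with rfl | hv
  · simp [gaussianReal_zero_var, integrable_dirac]
  have hv' : (0 : ℝ) < v := by positivity
  set b : ℝ := (1 - 2 * s * v) / (2 * v) with hb
  have hb0 : 0 < b := div_pos (by linarith) (by linarith)
  have hfun : (fun x : ℝ ↦ gaussianPDFReal 0 v x * Real.exp (s * x ^ 2)) =
      fun x ↦ (√(2 * Real.pi * v))⁻¹ * Real.exp (-b * x ^ 2) := by
    ext x
    rw [gaussianPDFReal, mul_assoc, ← Real.exp_add]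
    congr 2
    rw [hb]; field_simp; ring
  constructor
  · rw [gaussianReal_of_var_ne_zero _ hv]
    rw [integrable_withDensity_iff_integrable_smul' (by fun_prop) (by simp [gaussianPDF])]
    simp only [toReal_gaussianPDF, smul_eq_mul]
    rw [hfun]
    exact (integrable_exp_neg_mul_sq hb0).const_mul _
  · rw [integral_gaussianReal_eq_integral_smul hv]
    simp only [smul_eq_mul]
    rw [hfun, integral_const_mul, integral_gaussian, ← Real.sqrt_inv, ← Real.sqrt_inv,
      ← Real.sqrt_mul (by positivity)]
    congr 1
    rw [hb]
    have : 1 - 2 * s * v ≠ 0 := by linarith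
    have := Real.pi_ne_zero
    field_simp

lemma integral_exp_mul_sq_gaussianReal_le {v : ℝ≥0} {s : ℝ} (hs : |s * v| ≤ 1 / 6) :
    Integrable (fun x ↦ Real.exp (s * x ^ 2)) (gaussianReal 0 v) ∧
      ∫ x, Real.exp (s * x ^ 2) ∂gaussianReal 0 v ≤
        Real.exp (s * v + 3 / 2 * (s * v) ^ 2) := by
  have h := integrable_exp_mul_sq_gaussianReal (v := v) (s := s)
    (by linarith [(abs_le.1 hs).2])
  refine ⟨h.1, h.2.trans_le ?_⟩
  refine (inv_sqrt_one_sub_le_exp ?_).trans_eq ?_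
  · rw [mul_assoc, abs_mul, abs_two]; linarith
  · congr 1; ring

section Gaussian

variable {p : ℕ} {S : Matrix (Fin p) (Fin p) ℝ}

/-- Law of `x i + c x j` with `c = 1` or `c = -1`. The case `i = j` is allowed, and the variance
may vanish. -/
lemma hasLaw_add_mul_multivariateGaussian (hS : S.PosSemidef) (hdiag : ∀ i, S i i = 1)
    (i j : Fin p) {c : ℝ} (hc : c ^ 2 = 1) :
    HasLaw (fun x : EuclideanSpace ℝ (Fin p) ↦ x i + c * x j)
      (gaussianReal 0 (2 + 2 * c * S i j).toNNReal) (multivariateGaussian 0 S) where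
  aemeasurable := by fun_prop
  map_eq := by
    set L : StrongDual ℝ (EuclideanSpace ℝ (Fin p)) :=
      EuclideanSpace.proj i + c • EuclideanSpace.proj j with hL
    have hfun : (fun x : EuclideanSpace ℝ (Fin p) ↦ x i + c * x j) = L := by
      ext x; simp [hL]
    rw [hfun, IsGaussian.map_eq_gaussianReal, ContinuousLinearMap.integral_comp_id_comm]
    · rw [integral_id_multivariateGaussian, map_zero, ← hfun]
      congr 2
      have hm : ∀ k, MemLp (fun x : EuclideanSpace ℝ (Fin p) ↦ x k) 2
          (multivariateGaussian 0 S) := fun k ↦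
        IsGaussian.memLp_dual _ (EuclideanSpace.proj k) 2 (by simp)
      rw [variance_fun_add (hm i) ((hm j).const_mul c), variance_const_mul,
        covariance_const_mul_right, variance_eval_multivariateGaussian hS,
        variance_eval_multivariateGaussian hS, covariance_eval_multivariateGaussian hS,
        hdiag, hdiag, hc]
      ring
    · exact IsGaussian.integrable_id

/-- The entries of a correlation matrix are bounded by `1`: test the quadratic form on
`e i + e j` and `e i - e j`. -/
lemma abs_le_one_of_posSemidef (hS : S.PosSemidef) (hdiag : ∀ i, S i i = 1) (i j : Fin p) :
    |S i j| ≤ 1 := by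
  have h : ∀ c : ℝ, c ^ 2 = 1 → 0 ≤ 2 + 2 * c * S i j := by
    intro c hc
    have hsymm : S j i = S i j := by
      have := hS.1.apply i j; simpa using this
    have := hS.dotProduct_mulVec_nonneg (Pi.single i 1 + c • Pi.single j 1)
    simp [Matrix.mulVec_add, Matrix.mulVec_smul, hdiag, hsymm] at this
    nlinarith
  rw [abs_le]
  constructor
  · linarith [h 1 (by norm_num)]
  · linarith [h (-1) (by norm_num)]

/-- Sub-exponential bound for a centred product of two correlated standard normals. The product is
polarized as `x y = ((x + y) ^ 2 - (x - y) ^ 2) / 4`; after normalizing, the two exponential factors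
are decoupled by `2 a b ≤ a ^ 2 + b ^ 2`, so independence of `x + y` and `x - y` is not needed. -/
lemma integral_exp_mul_prod_sub_le (hS : S.PosSemidef) (hdiag : ∀ i, S i i = 1)
    (i j : Fin p) {l : ℝ} (hl : |l| ≤ 1 / 12) :
    Integrable (fun x : EuclideanSpace ℝ (Fin p) ↦ Real.exp (l * (x i * x j - S i j)))
        (multivariateGaussian 0 S) ∧
      ∫ x, Real.exp (l * (x i * x j - S i j)) ∂multivariateGaussian 0 S ≤
        Real.exp (3 * l ^ 2) := by
  have hρ := abs_le.1 (abs_le_one_of_posSemidef hS hdiag i j)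
  set ρ := S i j
  have hc1 : ((2 + 2 * 1 * ρ).toNNReal : ℝ) = 2 + 2 * ρ := by
    rw [Real.coe_toNNReal _ (by linarith)]; ring
  have hc2 : ((2 + 2 * (-1) * ρ).toNNReal : ℝ) = 2 - 2 * ρ := by
    rw [Real.coe_toNNReal _ (by linarith)]; ring
  have law1 := hasLaw_add_mul_multivariateGaussian hS hdiag i j (c := 1) (by norm_num)
  have law2 := hasLaw_add_mul_multivariateGaussian hS hdiag i j (c := -1) (by norm_num)
  have e1 := integral_exp_mul_sq_gaussianReal_le (v := (2 + 2 * 1 * ρ).toNNReal) (s := l / 2) (by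
    rw [hc1, abs_mul, abs_div, abs_two, abs_of_nonneg (by linarith : 0 ≤ 2 + 2 * ρ)]
    nlinarith [abs_nonneg l])
  have e2 := integral_exp_mul_sq_gaussianReal_le (v := (2 + 2 * (-1) * ρ).toNNReal) (s := -l / 2)
    (by
      rw [hc2, abs_mul, abs_div, abs_neg, abs_two, abs_of_nonneg (by linarith : 0 ≤ 2 - 2 * ρ)]
      nlinarith [abs_nonneg l])
  rw [hc1] at e1
  rw [hc2] at e2
  obtain ⟨i1, b1⟩ := e1
  obtain ⟨i2, b2⟩ := e2
  rw [← law1.map_eq] at i1 b1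
  rw [← law2.map_eq] at i2 b2
  rw [integral_map (by fun_prop) (by fun_prop)] at b1 b2
  have i1' := i1.comp_aemeasurable law1.aemeasurable
  have i2' := i2.comp_aemeasurable law2.aemeasurable
  simp only [Function.comp_def] at i1' i2'
  set E1 := l / 2 * (2 + 2 * ρ) + 3 / 2 * (l / 2 * (2 + 2 * ρ)) ^ 2 with hE1
  set E2 := -l / 2 * (2 - 2 * ρ) + 3 / 2 * (-l / 2 * (2 - 2 * ρ)) ^ 2 with hE2
  have hpt : ∀ x : EuclideanSpace ℝ (Fin p), Real.exp (l * (x i * x j - ρ)) ≤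
      Real.exp (3 * l ^ 2) / 2 *
        (Real.exp (-E1) * Real.exp (l / 2 * (x i + 1 * x j) ^ 2) +
          Real.exp (-E2) * Real.exp (-l / 2 * (x i + -1 * x j) ^ 2)) := by
    intro x
    -- `exp E1` and `exp E2` bound the two exponential moments, so both summands have mean at most 1.
    set a := (-E1 + l / 2 * (x i + 1 * x j) ^ 2) / 2 with ha
    set b := (-E2 + -l / 2 * (x i + -1 * x j) ^ 2) / 2 with hb
    have hle : l * (x i * x j - ρ) ≤ 3 * l ^ 2 + (a + b) := by
      rw [ha, hb, hE1, hE2]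
      nlinarith [mul_nonneg (sq_nonneg l) (mul_nonneg (by linarith : 0 ≤ 1 - ρ)
        (by linarith : 0 ≤ 1 + ρ))]
    have h2a : Real.exp (-E1) * Real.exp (l / 2 * (x i + 1 * x j) ^ 2) = Real.exp a ^ 2 := by
      rw [← Real.exp_add, ← Real.exp_nat_mul, ha]; congr 1; push_cast; ring
    have h2b : Real.exp (-E2) * Real.exp (-l / 2 * (x i + -1 * x j) ^ 2) = Real.exp b ^ 2 := by
      rw [← Real.exp_add, ← Real.exp_nat_mul, hb]; congr 1; push_cast; ring
    rw [h2a, h2b]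
    refine (Real.exp_le_exp.2 hle).trans ?_
    rw [Real.exp_add, Real.exp_add]
    nlinarith [mul_nonneg (Real.exp_pos (3 * l ^ 2)).le (sq_nonneg (Real.exp a - Real.exp b))]
  have hint := ((i1'.const_mul (Real.exp (-E1))).add
    (i2'.const_mul (Real.exp (-E2)))).const_mul (Real.exp (3 * l ^ 2) / 2)
  constructor
  · refine hint.mono' (by fun_prop) (ae_of_all _ fun x ↦ ?_)
    rw [Real.norm_of_nonneg (Real.exp_pos _).le]
    exact hpt x
  · refine (integral_mono_of_nonneg (ae_of_all _ fun x ↦ (Real.exp_pos _).le) hint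
      (ae_of_all _ hpt)).trans ?_
    simp only [Pi.add_apply]
    rw [integral_const_mul, integral_add (i1'.const_mul _) (i2'.const_mul _)]
    rw [integral_const_mul, integral_const_mul]
    have t1 := mul_le_mul_of_nonneg_left b1 (Real.exp_pos (-E1)).le
    have t2 := mul_le_mul_of_nonneg_left b2 (Real.exp_pos (-E2)).le
    rw [← Real.exp_add, neg_add_cancel, Real.exp_zero] at t1 t2
    calc _ ≤ Real.exp (3 * l ^ 2) / 2 * (1 + 1) := by gcongr
      _ = _ := by ring

end Gaussian

/-! ### Entries of the empirical covariance matrix -/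

/-- The `m`-th moment of the standard normal law. Only its finiteness and, for even `m`, its
nonnegativity matter. -/
noncomputable def gaussMoment (m : ℕ) : ℝ := ∫ x, x ^ m ∂gaussianReal 0 1

lemma gaussMoment_nonneg {m : ℕ} (hm : Even m) : 0 ≤ gaussMoment m :=
  integral_nonneg fun x ↦ hm.pow_nonneg x

lemma empCov_apply {n p : ℕ} (x : Fin n → EuclideanSpace ℝ (Fin p)) (i j : Fin p) :
    empCov x i j = (n : ℝ)⁻¹ * ∑ k, x k i * x k j := by
  simp [empCov, Matrix.sum_apply, Matrix.vecMulVec_apply]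

lemma empCov_sub_eq {n p : ℕ} (hn : 0 < n) (x : Fin n → EuclideanSpace ℝ (Fin p)) (i j : Fin p)
    (a : ℝ) : empCov x i j - a = (n : ℝ)⁻¹ * ∑ k, (x k i * x k j - a) := by
  rw [empCov_apply, Finset.sum_sub_distrib]
  have : (n : ℝ) ≠ 0 := by positivity
  simp
  field_simp

section Sample

variable {n p : ℕ} {S : Matrix (Fin p) (Fin p) ℝ} {Ω : Type*} [MeasurableSpace Ω]
  {P : Measure Ω} {X : Fin n → Ω → EuclideanSpace ℝ (Fin p)}

lemma IsGaussianSample.hasLaw_eval (hX : IsGaussianSample P S X) (hS : S.PosSemidef)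
    (hdiag : ∀ i, S i i = 1) (k : Fin n) (i : Fin p) :
    HasLaw (fun ω ↦ X k ω i) (gaussianReal 0 1) P := by
  have h := (measurePreserving_eval_multivariateGaussian (μ := 0) hS (i := i)).fun_comp_hasLaw
    (hX.2 k)
  simpa [hdiag] using h

lemma IsGaussianSample.memLp (hX : IsGaussianSample P S X) (hS : S.PosSemidef)
    (hdiag : ∀ i, S i i = 1) (k : Fin n) (i : Fin p) (r : ℝ≥0) :
    MemLp (fun ω ↦ X k ω i) r P := by
  have h := hX.hasLaw_eval hS hdiag k i
  have h2 := memLp_id_gaussianReal (μ := 0) (v := 1) r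
  rw [← h.map_eq] at h2
  exact h2.comp_of_map h.aemeasurable

lemma IsGaussianSample.integrable_pow [IsProbabilityMeasure P]
    (hX : IsGaussianSample P S X) (hS : S.PosSemidef)
    (hdiag : ∀ i, S i i = 1) (k : Fin n) (i : Fin p) (m : ℕ) :
    Integrable (fun ω ↦ X k ω i ^ m) P ∧ ∫ ω, X k ω i ^ m ∂P = gaussMoment m := by
  have h := hX.hasLaw_eval hS hdiag k i
  constructor
  · have := (hX.memLp hS hdiag k i m).integrable_norm_pow'
    refine this.mono ?_ (ae_of_all _ fun ω ↦ by simp)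
    have := h.aemeasurable
    exact (this.pow_const m).aestronglyMeasurable
  · exact h.integral_comp (f := fun x ↦ x ^ m) (by fun_prop)

lemma IsGaussianSample.integrable_mul_pow [IsProbabilityMeasure P]
    (hX : IsGaussianSample P S X) (hS : S.PosSemidef)
    (hdiag : ∀ i, S i i = 1) (k : Fin n) (i j : Fin p) {m : ℕ} (hm : Even m) :
    Integrable (fun ω ↦ (X k ω i * X k ω j) ^ m) P ∧
      ∫ ω, (X k ω i * X k ω j) ^ m ∂P ≤ gaussMoment (2 * m) := by
  obtain ⟨h1, e1⟩ := hX.integrable_pow hS hdiag k i (2 * m)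
  obtain ⟨h2, e2⟩ := hX.integrable_pow hS hdiag k j (2 * m)
  have hpt : ∀ ω, (X k ω i * X k ω j) ^ m ≤ (1 / 2) * (X k ω i ^ (2 * m) + X k ω j ^ (2 * m)) := by
    intro ω
    rw [mul_pow, mul_comm 2 m, pow_mul, pow_mul]
    nlinarith [sq_nonneg (X k ω i ^ m - X k ω j ^ m)]
  have hint := (h1.add h2).const_mul (1 / 2)
  have hmeas : AEMeasurable (fun ω ↦ (X k ω i * X k ω j) ^ m) P :=
    (((hX.hasLaw_eval hS hdiag k i).aemeasurable).mul
      ((hX.hasLaw_eval hS hdiag k j).aemeasurable)).pow_const m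
  constructor
  · refine hint.mono' hmeas.aestronglyMeasurable (ae_of_all _ fun ω ↦ ?_)
    rw [Real.norm_of_nonneg (hm.pow_nonneg _)]
    exact hpt ω
  · refine (integral_mono_of_nonneg (ae_of_all _ fun ω ↦ hm.pow_nonneg _) hint
      (ae_of_all _ hpt)).trans ?_
    simp only [Pi.add_apply]
    rw [integral_const_mul, integral_add h1 h2, e1, e2]
    linarith

lemma IsGaussianSample.integral_mul [IsProbabilityMeasure P]
    (hX : IsGaussianSample P S X) (hS : S.PosSemidef)
    (hdiag : ∀ i, S i i = 1) (k : Fin n) (i j : Fin p) :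
    ∫ ω, X k ω i * X k ω j ∂P = S i j := by
  have hc := (hX.2 k).covariance_fun_comp (f := fun x ↦ x i) (g := fun x ↦ x j)
    (by fun_prop) (by fun_prop)
  rw [covariance_eval_multivariateGaussian hS, covariance_eq_sub
    (hX.memLp hS hdiag k i 2) (hX.memLp hS hdiag k j 2)] at hc
  have hi : ∫ ω, X k ω i ∂P = 0 := by
    rw [(hX.hasLaw_eval hS hdiag k i).integral_eq]; exact integral_id_gaussianReal
  rw [hi] at hc
  simpa using hc

/-- The products of two fixed coordinates are independent across the sample. -/
lemma IsGaussianSample.iIndepFun_mul_sub (hX : IsGaussianSample P S X) (i j : Fin p) (a : ℝ) :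
    iIndepFun (fun k ω ↦ X k ω i * X k ω j - a) P :=
  hX.1.comp (fun _ x ↦ x i * x j - a) (fun _ ↦ by fun_prop)

lemma IsGaussianSample.aemeasurable_mul_sub (hX : IsGaussianSample P S X) (i j : Fin p) (a : ℝ)
    (k : Fin n) : AEMeasurable (fun ω ↦ X k ω i * X k ω j - a) P := by
  have h : Measurable fun x : EuclideanSpace ℝ (Fin p) ↦ x i * x j - a := by fun_prop
  exact h.comp_aemeasurable (hX.2 k).aemeasurable

lemma IsGaussianSample.aemeasurable_empCov (hX : IsGaussianSample P S X) (i j : Fin p) :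
    AEMeasurable (fun ω ↦ empCov (fun k ↦ X k ω) i j) P := by
  have hx := fun k ↦ hX.aemeasurable_mul_sub i j 0 k
  simp only [empCov_apply, sub_zero] at hx ⊢
  fun_prop

/-- The entries of the empirical covariance are averages of `n` independent products with mean
`S i j` and variance at most `gaussMoment 4`. -/
lemma IsGaussianSample.integrable_empCov_sub_sq [IsProbabilityMeasure P] (hn : 0 < n)
    (hX : IsGaussianSample P S X)
    (hS : S.PosSemidef) (hdiag : ∀ i, S i i = 1) (i j : Fin p) :
    Integrable (fun ω ↦ (empCov (fun k ↦ X k ω) i j - S i j) ^ 2) P ∧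
      ∫ ω, (empCov (fun k ↦ X k ω) i j - S i j) ^ 2 ∂P ≤ gaussMoment 4 / n := by
  set Y : Fin n → Ω → ℝ := fun k ω ↦ X k ω i * X k ω j - S i j with hY
  have hprod : ∀ k, MemLp (fun ω ↦ X k ω i * X k ω j) 2 P := fun k ↦ by
    rw [memLp_two_iff_integrable_sq]
    · exact (hX.integrable_mul_pow hS hdiag k i j even_two).1
    · simpa using (hX.aemeasurable_mul_sub i j 0 k).aestronglyMeasurable
  have hYmem : ∀ k, MemLp (Y k) 2 P := fun k ↦ (hprod k).sub (memLp_const _)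
  have hYmean : ∀ k, ∫ ω, Y k ω ∂P = 0 := fun k ↦ by
    simp only [hY]
    rw [integral_sub ((hprod k).integrable (by norm_num)) (integrable_const _),
      hX.integral_mul hS hdiag]
    simp
  have hYvar : ∀ k, Var[Y k; P] ≤ gaussMoment 4 := fun k ↦ by
    simp only [hY]
    rw [variance_sub_const (hprod k).aestronglyMeasurable]
    exact (variance_le_expectation_sq (hprod k).aestronglyMeasurable).trans
      (hX.integrable_mul_pow hS hdiag k i j even_two).2
  have hsum : MemLp (∑ k, Y k) 2 P := memLp_finsetSum' _ fun k _ ↦ hYmem k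
  have hfun : (fun ω ↦ (empCov (fun k ↦ X k ω) i j - S i j) ^ 2) =
      fun ω ↦ ((n : ℝ)⁻¹) ^ 2 * (∑ k, Y k) ω ^ 2 := by
    ext ω
    rw [empCov_sub_eq hn, mul_pow, Finset.sum_apply]
  rw [hfun]
  refine ⟨hsum.integrable_sq.const_mul _, ?_⟩
  have hmean : ∫ ω, (∑ k, Y k) ω ∂P = 0 := by
    simp only [Finset.sum_apply]
    rw [integral_finsetSum _ fun k _ ↦ (hYmem k).integrable (by norm_num)]
    simp [hYmean]
  have hvar : ∫ ω, (∑ k, Y k) ω ^ 2 ∂P = ∑ k, Var[Y k; P] := by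
    rw [← variance_of_integral_eq_zero hsum.aemeasurable hmean]
    exact IndepFun.variance_sum (fun k _ ↦ hYmem k)
      fun k _ l _ hkl ↦ (hX.iIndepFun_mul_sub i j (S i j)).indepFun hkl
  rw [integral_const_mul, hvar]
  have : ∑ k, Var[Y k; P] ≤ n * gaussMoment 4 :=
    (Finset.sum_le_sum fun k _ ↦ hYvar k).trans_eq (by simp)
  have hn' : (0 : ℝ) < n := by positivity
  calc _ ≤ ((n : ℝ)⁻¹) ^ 2 * (n * gaussMoment 4) := by gcongr
    _ = _ := by field_simp

lemma IsGaussianSample.integrable_empCov_pow_eight [IsProbabilityMeasure P] (hn : 0 < n)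
    (hX : IsGaussianSample P S X)
    (hS : S.PosSemidef) (hdiag : ∀ i, S i i = 1) (i j : Fin p) :
    Integrable (fun ω ↦ empCov (fun k ↦ X k ω) i j ^ 8) P ∧
      ∫ ω, empCov (fun k ↦ X k ω) i j ^ 8 ∂P ≤ gaussMoment 16 := by
  have he : Even 8 := by decide
  have hn' : (0 : ℝ) < n := by positivity
  have hpt : ∀ ω, empCov (fun k ↦ X k ω) i j ^ 8 ≤
      ∑ k, (n : ℝ)⁻¹ * (X k ω i * X k ω j) ^ 8 := fun ω ↦ by
    rw [empCov_apply, Finset.mul_sum]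
    exact Real.pow_arith_mean_le_arith_mean_pow_of_even Finset.univ (fun _ ↦ (n : ℝ)⁻¹) _
      (fun _ _ ↦ by positivity) (by simp; field_simp) he
  have hterm := fun k ↦ hX.integrable_mul_pow hS hdiag k i j he
  have hint : Integrable (fun ω ↦ ∑ k, (n : ℝ)⁻¹ * (X k ω i * X k ω j) ^ 8) P :=
    integrable_finsetSum _ fun k _ ↦ (hterm k).1.const_mul _
  constructor
  · refine hint.mono' ((hX.aemeasurable_empCov i j).pow_const 8).aestronglyMeasurable
      (ae_of_all _ fun ω ↦ ?_)
    rw [Real.norm_of_nonneg (he.pow_nonneg _)]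
    exact hpt ω
  · refine (integral_mono_of_nonneg (ae_of_all _ fun ω ↦ he.pow_nonneg _) hint
      (ae_of_all _ hpt)).trans ?_
    rw [integral_finsetSum _ fun k _ ↦ (hterm k).1.const_mul _]
    simp only [integral_const_mul]
    calc _ ≤ ∑ k : Fin n, (n : ℝ)⁻¹ * gaussMoment 16 := by
          gcongr with k; exact (hterm k).2
      _ = gaussMoment 16 := by simp; field_simp

/-- Moment generating function of a sum over the sample of centred products. -/
lemma IsGaussianSample.integrable_exp_sum [IsProbabilityMeasure P] (hX : IsGaussianSample P S X)
    (hS : S.PosSemidef) (hdiag : ∀ i, S i i = 1) (i j : Fin p) {l : ℝ} (hl : |l| ≤ 1 / 12) :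
    Integrable (fun ω ↦ Real.exp (l * (∑ k, fun ω ↦ X k ω i * X k ω j - S i j) ω)) P ∧
      mgf (∑ k, fun ω ↦ X k ω i * X k ω j - S i j) P l ≤ Real.exp (n * (3 * l ^ 2)) := by
  have hone : ∀ k, Integrable (fun ω ↦ Real.exp (l * (X k ω i * X k ω j - S i j))) P ∧
      mgf (fun ω ↦ X k ω i * X k ω j - S i j) P l ≤ Real.exp (3 * l ^ 2) := fun k ↦ by
    obtain ⟨h1, h2⟩ := integral_exp_mul_prod_sub_le hS hdiag i j hl
    constructor
    · rw [← (hX.2 k).map_eq] at h1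
      exact h1.comp_aemeasurable (hX.2 k).aemeasurable
    · rw [← (hX.2 k).integral_comp (by fun_prop)] at h2
      exact h2
  have hind := hX.iIndepFun_mul_sub i j (S i j)
  have hmeas := hX.aemeasurable_mul_sub i j (S i j)
  constructor
  · -- A non-integrable exponential would have the junk value `0` as its generating function.
    by_contra hcon
    have h0 := hind.mgf_sum₀ (t := l) hmeas Finset.univ
    rw [mgf_undef hcon] at h0
    exact (Finset.prod_pos fun k _ ↦ mgf_pos (hone k).1).ne h0
  · rw [hind.mgf_sum₀ hmeas]
    refine (Finset.prod_le_prod (fun k _ ↦ mgf_nonneg) fun k _ ↦ (hone k).2).trans_eq ?_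
    rw [Finset.prod_const, ← Real.exp_nat_mul]
    simp

/-- Deviation inequality for an entry of the empirical covariance matrix, by Chernoff's method
with parameter `t / 6`. -/
lemma IsGaussianSample.measureReal_le_abs_empCov_sub_le [IsProbabilityMeasure P] (hn : 0 < n)
    (hX : IsGaussianSample P S X)
    (hS : S.PosSemidef) (hdiag : ∀ i, S i i = 1) (i j : Fin p) {t : ℝ} (ht : 0 ≤ t)
    (ht2 : t ≤ 1 / 2) :
    P.real {ω | t ≤ |empCov (fun k ↦ X k ω) i j - S i j|} ≤ 2 * Real.exp (-(n * t ^ 2 / 12)) := by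
  have hn' : (0 : ℝ) < n := by positivity
  set Z : Ω → ℝ := ∑ k, fun ω ↦ X k ω i * X k ω j - S i j with hZ
  have hZe : ∀ ω, empCov (fun k ↦ X k ω) i j - S i j = (n : ℝ)⁻¹ * Z ω := fun ω ↦ by
    rw [empCov_sub_eq hn, hZ, Finset.sum_apply]
  have hsub : {ω | t ≤ |empCov (fun k ↦ X k ω) i j - S i j|} ⊆
      {ω | n * t ≤ Z ω} ∪ {ω | Z ω ≤ -(n * t)} := by
    intro ω hω
    simp only [Set.mem_ofPred_eq, hZe, abs_mul, abs_inv, Nat.abs_cast, Set.mem_union] at hω ⊢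
    rw [inv_mul_eq_div, le_div_iff₀' hn', le_abs] at hω
    exact hω.imp id fun h ↦ by linarith
  obtain ⟨i1, b1⟩ := hX.integrable_exp_sum hS hdiag i j (l := t / 6)
    (by rw [abs_of_nonneg (by positivity)]; linarith)
  obtain ⟨i2, b2⟩ := hX.integrable_exp_sum hS hdiag i j (l := -(t / 6))
    (by rw [abs_neg, abs_of_nonneg (by positivity)]; linarith)
  have c1 := measure_ge_le_exp_mul_mgf (n * t) (by positivity) i1
  have c2 := measure_le_le_exp_mul_mgf (-(n * t)) (by linarith) i2
  have d1 := c1.trans (mul_le_mul_of_nonneg_left b1 (Real.exp_pos _).le)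
  have d2 := c2.trans (mul_le_mul_of_nonneg_left b2 (Real.exp_pos _).le)
  rw [← Real.exp_add] at d1 d2
  have f1 : -(t / 6) * (n * t) + n * (3 * (t / 6) ^ 2) = -(n * t ^ 2 / 12) := by ring
  have f2 : -(-(t / 6)) * (-(n * t)) + n * (3 * (-(t / 6)) ^ 2) = -(n * t ^ 2 / 12) := by ring
  rw [f1] at d1
  rw [f2] at d2
  calc _ ≤ P.real ({ω | n * t ≤ Z ω} ∪ {ω | Z ω ≤ -(n * t)}) := measureReal_mono hsub
    _ ≤ _ := measureReal_union_le _ _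
    _ ≤ _ := by linarith

end Sample

/-! ### Hard thresholding of a single entry -/

lemma absPow_nonneg (q x : ℝ) : 0 ≤ absPow q x := by
  unfold absPow; split_ifs <;> positivity

/-- Elementary comparison: `τ ^ 2` is at most `4 |x| ^ q τ ^ (2 - q)` as soon as `τ ≤ 2 |x|`. -/
lemma sq_le_absPow_mul_rpow {q τ x : ℝ} (hq0 : 0 ≤ q) (hq2 : q < 2) (hτ : 0 < τ)
    (hx : τ ≤ 2 * |x|) : τ ^ 2 ≤ 4 * (absPow q x * τ ^ (2 - q)) := by
  have hx0 : 0 < |x| := by linarith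
  have h1 : τ ^ q ≤ 4 * |x| ^ q := by
    calc τ ^ q ≤ (2 * |x|) ^ q := Real.rpow_le_rpow hτ.le hx hq0
      _ = 2 ^ q * |x| ^ q := Real.mul_rpow (by norm_num) hx0.le
      _ ≤ 2 ^ (2 : ℝ) * |x| ^ q := by gcongr; norm_num
      _ = 4 * |x| ^ q := by norm_num
  have h2 : τ ^ 2 = τ ^ q * τ ^ (2 - q) := by
    rw [← Real.rpow_add hτ, ← Real.rpow_natCast]; norm_num
  rw [h2, absPow, if_neg (abs_pos.1 hx0), ← mul_assoc]
  gcongr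

/-- Below the threshold the squared entry itself is controlled: `x ^ 2 ≤ 4 |x| ^ q τ ^ (2 - q)` if
`|x| ≤ 2 τ`. -/
lemma sq_le_absPow_mul_rpow_of_le {q τ x : ℝ} (hq0 : 0 ≤ q) (hq2 : q < 2) (hτ : 0 < τ)
    (hx : |x| ≤ 2 * τ) : x ^ 2 ≤ 4 * (absPow q x * τ ^ (2 - q)) := by
  rcases eq_or_ne x 0 with rfl | h0
  · simp [absPow]
  have hx0 : 0 < |x| := abs_pos.2 h0
  have h1 : |x| ^ (2 - q) ≤ 4 * τ ^ (2 - q) := by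
    calc |x| ^ (2 - q) ≤ (2 * τ) ^ (2 - q) := Real.rpow_le_rpow hx0.le hx (by linarith)
      _ = 2 ^ (2 - q) * τ ^ (2 - q) := Real.mul_rpow (by norm_num) hτ.le
      _ ≤ 2 ^ (2 : ℝ) * τ ^ (2 - q) := by
        gcongr
        · norm_num
        · linarith
      _ = 4 * τ ^ (2 - q) := by norm_num
  have h2 : x ^ 2 = |x| ^ q * |x| ^ (2 - q) := by
    rw [← Real.rpow_add hx0, ← sq_abs, ← Real.rpow_natCast]; norm_num
  rw [h2, absPow, if_neg h0]
  have : 0 ≤ |x| ^ q := by positivity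
  nlinarith

/-- Error of hard thresholding one entry `x` from an observation `y` with `|y - x| ≤ τ / 2`: up to
the linear term `2 x (y - x)`, needed only for `|x| > 2 τ`, the squared entry is estimated with an
error of order `|x| ^ q τ ^ (2 - q)`. -/
lemma abs_threshold_sq_sub_le {q τ x y : ℝ} (hq0 : 0 ≤ q) (hq2 : q < 2) (hτ : 0 < τ)
    (hxy : |y - x| ≤ τ / 2) :
    |(if τ < |y| then y else 0) ^ 2 - x ^ 2 - (if 2 * τ < |x| then 2 * x else 0) * (y - x)| ≤
      9 * (absPow q x * τ ^ (2 - q)) := by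
  have hnn : 0 ≤ absPow q x * τ ^ (2 - q) := mul_nonneg (absPow_nonneg _ _) (by positivity)
  have hy1 : |y| ≤ |x| + τ / 2 := by
    have := abs_add_le x (y - x); rw [add_sub_cancel] at this; linarith
  have hx1 : |x| ≤ |y| + τ / 2 := by
    have := abs_add_le y (x - y); rw [add_sub_cancel, abs_sub_comm x y] at this; linarith
  by_cases hx : 2 * τ < |x|
  · rw [if_pos hx, if_pos (by linarith)]
    have h1 := sq_le_absPow_mul_rpow hq0 hq2 hτ (x := x) (by linarith)
    have h2 : y ^ 2 - x ^ 2 - 2 * x * (y - x) = (y - x) ^ 2 := by ring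
    have h3 : (y - x) ^ 2 ≤ (τ / 2) ^ 2 := sq_le_sq' (by linarith [(abs_le.1 hxy).1])
      (abs_le.1 hxy).2
    rw [h2, abs_of_nonneg (sq_nonneg _)]
    nlinarith
  · rw [if_neg hx, zero_mul, sub_zero]
    push Not at hx
    by_cases hy : τ < |y|
    · rw [if_pos hy]
      have h1 := sq_le_absPow_mul_rpow hq0 hq2 hτ (x := x) (by linarith)
      have h2 : y ^ 2 - x ^ 2 = (y - x) * (y + x) := by ring
      have h3 : |y + x| ≤ 9 / 2 * τ := (abs_add_le _ _).trans (by linarith)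
      rw [h2, abs_mul]
      have h4 := mul_le_mul hxy h3 (abs_nonneg _) (by linarith)
      nlinarith
    · rw [if_neg hy]
      have h1 := sq_le_absPow_mul_rpow_of_le hq0 hq2 hτ hx
      have h2 : |(0 : ℝ) ^ 2 - x ^ 2| = x ^ 2 := by
        rw [zero_pow two_ne_zero, zero_sub, abs_neg, abs_of_nonneg (sq_nonneg _)]
      rw [h2]; linarith

/-- Comparison of the `ℓ¹` and `ℓ^q` sizes of an entry that lies above the threshold. -/
lemma abs_le_absPow_mul_max {q τ x : ℝ} (hτ : 0 < τ) (hx1 : |x| ≤ 1) (hx : 2 * τ < |x|) :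
    |x| ≤ absPow q x * max 1 (τ ^ (1 - q)) := by
  have hx0 : 0 < |x| := by linarith
  have h1 : |x| ^ (1 - q) ≤ max 1 (τ ^ (1 - q)) := by
    rcases le_total q 1 with hq | hq
    · exact (Real.rpow_le_one hx0.le hx1 (by linarith)).trans (le_max_left _ _)
    · exact (Real.rpow_le_rpow_of_nonpos hτ (by linarith) (by linarith)).trans (le_max_right _ _)
  have h2 : |x| = |x| ^ q * |x| ^ (1 - q) := by
    rw [← Real.rpow_add hx0]; simp
  rw [absPow, if_neg (abs_pos.1 hx0)]
  calc |x| = |x| ^ q * |x| ^ (1 - q) := h2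
    _ ≤ _ := by gcongr

/-- Crude bound for the squared error of one thresholded entry, valid without any control of
`y - x`. -/
lemma threshold_sq_sub_pow_four_le {τ x y : ℝ} (hx : |x| ≤ 1) :
    ((if τ < |y| then y else 0) ^ 2 - x ^ 2) ^ 4 ≤ y ^ 8 + 1 := by
  set z := (if τ < |y| then y else 0) with hz
  have hzy : z ^ 2 ≤ y ^ 2 := by rw [hz]; split_ifs <;> [exact le_rfl; simpa using sq_nonneg y]
  have hx2 : x ^ 2 ≤ 1 := (sq_le_one_iff_abs_le_one x).2 hx
  have h4 : ((z ^ 2 - x ^ 2) ^ 2) ^ 2 ≤ (max (y ^ 2) 1) ^ 4 := by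
    rw [← pow_mul]
    have : |z ^ 2 - x ^ 2| ≤ max (y ^ 2) 1 := by
      rw [abs_le]
      constructor
      · linarith [le_max_right (y ^ 2) 1, sq_nonneg z]
      · linarith [le_max_left (y ^ 2) 1, sq_nonneg x]
    rw [← (by decide : Even 4).pow_abs]
    gcongr
  rw [← pow_mul] at h4
  refine h4.trans ?_
  rcases max_choice (y ^ 2) 1 with h | h <;> rw [h]
  · rw [← pow_mul]; norm_num
  · have : 0 ≤ y ^ 8 := by positivity
    linarith

/-! ### Sums over off-diagonal entries -/

lemma sum_ite_ne_eq_sum_offDiag {p : ℕ} (f : Fin p → Fin p → ℝ) :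
    ∑ i, ∑ j, (if i ≠ j then f i j else 0) =
      ∑ e ∈ (Finset.univ : Finset (Fin p)).offDiag, f e.1 e.2 := by
  rw [← Finset.sum_product', ← Finset.sum_filter]
  congr 1
  ext; simp

lemma offDiagQuad_eq {p : ℕ} (A : Matrix (Fin p) (Fin p) ℝ) :
    offDiagQuad A = ∑ e ∈ (Finset.univ : Finset (Fin p)).offDiag, A e.1 e.2 ^ 2 :=
  sum_ite_ne_eq_sum_offDiag fun i j ↦ A i j ^ 2

lemma quadEstimator_eq {n p : ℕ} (τ : ℝ) (x : Fin n → EuclideanSpace ℝ (Fin p)) :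
    quadEstimator τ x = ∑ e ∈ (Finset.univ : Finset (Fin p)).offDiag,
      (if τ < |empCov x e.1 e.2| then empCov x e.1 e.2 else 0) ^ 2 := by
  rw [quadEstimator, offDiagQuad_eq]
  refine Finset.sum_congr rfl fun e he ↦ ?_
  rw [hardThreshold, Matrix.of_apply, if_neg (Finset.mem_offDiag.1 he).2.2]

/-- Cauchy–Schwarz for a weighted sum. -/
lemma sum_mul_sq_le {ι : Type*} (s : Finset ι) (a z : ι → ℝ) :
    (∑ e ∈ s, a e * z e) ^ 2 ≤ (∑ e ∈ s, |a e|) * ∑ e ∈ s, |a e| * z e ^ 2 :=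
  Finset.sum_sq_le_sum_mul_sum_of_sq_le_mul s (fun _ _ ↦ abs_nonneg _)
    (fun _ _ ↦ by positivity) fun e _ ↦ by
      rw [mul_pow, ← sq_abs (a e)]; exact le_of_eq (by ring)

lemma sum_pow_four_le {ι : Type*} (s : Finset ι) (d : ι → ℝ) :
    (∑ e ∈ s, d e) ^ 4 ≤ (s.card : ℝ) ^ 3 * ∑ e ∈ s, d e ^ 4 := by
  have h1 := sq_sum_le_card_mul_sum_sq (s := s) (f := d)
  have h2 := sq_sum_le_card_mul_sum_sq (s := s) (f := fun e ↦ d e ^ 2)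
  simp only [← pow_mul] at h2
  calc (∑ e ∈ s, d e) ^ 4 = ((∑ e ∈ s, d e) ^ 2) ^ 2 := by ring
    _ ≤ ((s.card : ℝ) * ∑ e ∈ s, d e ^ 2) ^ 2 := by gcongr
    _ = (s.card : ℝ) ^ 2 * (∑ e ∈ s, d e ^ 2) ^ 2 := by ring
    _ ≤ (s.card : ℝ) ^ 2 * (s.card * ∑ e ∈ s, d e ^ 4) := by gcongr
    _ = _ := by ring

/-! ### Risk bound with explicit terms -/

lemma measurable_quadEstimator {n p : ℕ} (τ : ℝ) :
    Measurable (quadEstimator τ : (Fin n → EuclideanSpace ℝ (Fin p)) → ℝ) := by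
  have h : ∀ i j, Measurable fun x : Fin n → EuclideanSpace ℝ (Fin p) ↦ empCov x i j := by
    intro i j
    simp only [empCov_apply]
    fun_prop
  have he : (quadEstimator τ : (Fin n → EuclideanSpace ℝ (Fin p)) → ℝ) = fun x ↦
      ∑ e ∈ (Finset.univ : Finset (Fin p)).offDiag,
        (if τ < |empCov x e.1 e.2| then empCov x e.1 e.2 else 0) ^ 2 := by
    ext x; exact quadEstimator_eq τ x
  rw [he]
  refine Finset.measurable_sum _ fun e _ ↦ (Measurable.ite ?_ (h _ _) measurable_const).pow_const 2
  exact measurableSet_lt measurable_const (h _ _).abs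

/-- The coefficients of the linear terms, those with `2 τ < |S i j|`, have total size at most `2 R` up to
the factor `max 1 (τ ^ (1 - q))`. -/
lemma sum_abs_linear_coeff_le {p : ℕ} {q R τ : ℝ} (hτ : 0 < τ)
    {S : Matrix (Fin p) (Fin p) ℝ} (hS1 : ∀ i j, |S i j| ≤ 1)
    (hSR : ∑ e ∈ (Finset.univ : Finset (Fin p)).offDiag, absPow q (S e.1 e.2) ≤ R) :
    ∑ e ∈ (Finset.univ : Finset (Fin p)).offDiag,
      |if 2 * τ < |S e.1 e.2| then 2 * S e.1 e.2 else 0| ≤ 2 * (R * max 1 (τ ^ (1 - q))) := by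
  have hW : 0 ≤ max 1 (τ ^ (1 - q)) := zero_le_one.trans (le_max_left _ _)
  calc _ ≤ ∑ e ∈ (Finset.univ : Finset (Fin p)).offDiag,
        2 * (absPow q (S e.1 e.2) * max 1 (τ ^ (1 - q))) := by
        refine Finset.sum_le_sum fun e _ ↦ ?_
        split_ifs with h
        · rw [abs_mul, abs_two]
          gcongr
          exact abs_le_absPow_mul_max hτ (hS1 _ _) h
        · rw [abs_zero]
          have := absPow_nonneg q (S e.1 e.2)
          positivity
    _ = 2 * ((∑ e ∈ (Finset.univ : Finset (Fin p)).offDiag, absPow q (S e.1 e.2)) *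
          max 1 (τ ^ (1 - q))) := by
        rw [← Finset.mul_sum, Finset.sum_mul]
    _ ≤ _ := by gcongr

lemma card_offDiag_univ_le (p : ℕ) :
    (((Finset.univ : Finset (Fin p)).offDiag.card : ℕ) : ℝ) ≤ (p : ℝ) ^ 2 := by
  have : (Finset.univ : Finset (Fin p)).offDiag.card ≤ p ^ 2 := by
    rw [Finset.offDiag_card]; simp [sq]
  exact_mod_cast this

/-- Deterministic bound for the squared error. On the event where all off-diagonal entries of the
empirical covariance are within `τ / 2` of the truth, the first two terms suffice; off this event
`D ^ 2 ≤ (ε D ^ 4 + ε⁻¹) / 2` is used with a free parameter `ε`, which gives the last two terms. -/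
lemma sq_quadEstimator_sub_le {n p : ℕ} {q R τ ε : ℝ} (hq0 : 0 ≤ q) (hq2 : q < 2) (hτ : 0 < τ)
    (hR : 0 ≤ R) (hε : 0 < ε) {S : Matrix (Fin p) (Fin p) ℝ} (hS1 : ∀ i j, |S i j| ≤ 1)
    (hSR : ∑ e ∈ (Finset.univ : Finset (Fin p)).offDiag, absPow q (S e.1 e.2) ≤ R)
    (x : Fin n → EuclideanSpace ℝ (Fin p)) :
    (quadEstimator τ x - offDiagQuad S) ^ 2 ≤
      162 * (R * τ ^ (2 - q)) ^ 2 +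
      4 * (R * max 1 (τ ^ (1 - q))) *
        ∑ e ∈ (Finset.univ : Finset (Fin p)).offDiag,
          |if 2 * τ < |S e.1 e.2| then 2 * S e.1 e.2 else 0| *
            (empCov x e.1 e.2 - S e.1 e.2) ^ 2 +
      ε / 2 * ((p : ℝ) ^ 6 *
        ∑ e ∈ (Finset.univ : Finset (Fin p)).offDiag, (empCov x e.1 e.2 ^ 8 + 1)) +
      ε⁻¹ / 2 * ∑ e ∈ (Finset.univ : Finset (Fin p)).offDiag,
        (if τ / 2 ≤ |empCov x e.1 e.2 - S e.1 e.2| then 1 else 0) := by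
  set s := (Finset.univ : Finset (Fin p)).offDiag
  set W := max 1 (τ ^ (1 - q))
  have hW0 : 0 ≤ W := zero_le_one.trans (le_max_left _ _)
  set a : Fin p × Fin p → ℝ := fun e ↦ if 2 * τ < |S e.1 e.2| then 2 * S e.1 e.2 else 0
  set y : Fin p × Fin p → ℝ := fun e ↦ empCov x e.1 e.2
  set d : Fin p × Fin p → ℝ := fun e ↦ (if τ < |y e| then y e else 0) ^ 2 - S e.1 e.2 ^ 2
  have hD : quadEstimator τ x - offDiagQuad S = ∑ e ∈ s, d e := by
    rw [quadEstimator_eq, offDiagQuad_eq, ← Finset.sum_sub_distrib]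
  have h1 : 0 ≤ 162 * (R * τ ^ (2 - q)) ^ 2 := by positivity
  have h2 : 0 ≤ 4 * (R * W) * ∑ e ∈ s, |a e| * (y e - S e.1 e.2) ^ 2 := by positivity
  have h3 : 0 ≤ ε / 2 * ((p : ℝ) ^ 6 * ∑ e ∈ s, (y e ^ 8 + 1)) := by positivity
  have h4 : 0 ≤ ε⁻¹ / 2 * ∑ e ∈ s, (if τ / 2 ≤ |y e - S e.1 e.2| then (1 : ℝ) else 0) := by
    refine mul_nonneg (by positivity) (Finset.sum_nonneg fun e _ ↦ ?_)
    split_ifs <;> norm_num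
  rw [hD]
  by_cases hgood : ∀ e ∈ s, |y e - S e.1 e.2| ≤ τ / 2
  · set L := ∑ e ∈ s, a e * (y e - S e.1 e.2) with hL
    have hlin : |∑ e ∈ s, d e - L| ≤ 9 * (R * τ ^ (2 - q)) := by
      rw [hL, ← Finset.sum_sub_distrib]
      calc _ ≤ ∑ e ∈ s, |d e - a e * (y e - S e.1 e.2)| := Finset.abs_sum_le_sum_abs _ _
        _ ≤ ∑ e ∈ s, 9 * (absPow q (S e.1 e.2) * τ ^ (2 - q)) :=
          Finset.sum_le_sum fun e he ↦ abs_threshold_sq_sub_le hq0 hq2 hτ (hgood e he)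
        _ = 9 * ((∑ e ∈ s, absPow q (S e.1 e.2)) * τ ^ (2 - q)) := by
          rw [← Finset.mul_sum, Finset.sum_mul]
        _ ≤ _ := by gcongr
    have hlin2 : (∑ e ∈ s, d e - L) ^ 2 ≤ (9 * (R * τ ^ (2 - q))) ^ 2 :=
      sq_le_sq' (abs_le.1 hlin).1 (abs_le.1 hlin).2
    have hL2 : L ^ 2 ≤ 2 * (R * W) * ∑ e ∈ s, |a e| * (y e - S e.1 e.2) ^ 2 := by
      refine (sum_mul_sq_le s a _).trans ?_
      gcongr
      exact sum_abs_linear_coeff_le hτ hS1 hSR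
    nlinarith [sq_nonneg (∑ e ∈ s, d e - 2 * L)]
  · push Not at hgood
    obtain ⟨e₀, he₀, hbad⟩ := hgood
    have hone : 1 ≤ ∑ e ∈ s, (if τ / 2 ≤ |y e - S e.1 e.2| then (1 : ℝ) else 0) := by
      calc (1 : ℝ) = if τ / 2 ≤ |y e₀ - S e₀.1 e₀.2| then (1 : ℝ) else 0 := by rw [if_pos hbad.le]
        _ ≤ _ := Finset.single_le_sum
          (f := fun e ↦ if τ / 2 ≤ |y e - S e.1 e.2| then (1 : ℝ) else 0)
          (fun e _ ↦ by split_ifs <;> norm_num) he₀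
    have hfour : (∑ e ∈ s, d e) ^ 4 ≤ (p : ℝ) ^ 6 * ∑ e ∈ s, (y e ^ 8 + 1) := by
      refine (sum_pow_four_le s d).trans ?_
      have hc : (s.card : ℝ) ^ 3 ≤ (p : ℝ) ^ 6 := by
        calc (s.card : ℝ) ^ 3 ≤ ((p : ℝ) ^ 2) ^ 3 := by
              gcongr; exact card_offDiag_univ_le p
          _ = (p : ℝ) ^ 6 := by ring
      gcongr with e
      exact threshold_sq_sub_pow_four_le (hS1 _ _)
    have hamgm : (∑ e ∈ s, d e) ^ 2 ≤ ε / 2 * (∑ e ∈ s, d e) ^ 4 + ε⁻¹ / 2 := by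
      have : ε / 2 * (∑ e ∈ s, d e) ^ 4 + ε⁻¹ / 2 - (∑ e ∈ s, d e) ^ 2 =
          ε / 2 * ((∑ e ∈ s, d e) ^ 2 - ε⁻¹) ^ 2 := by field_simp; ring
      have h5 : 0 ≤ ε / 2 * ((∑ e ∈ s, d e) ^ 2 - ε⁻¹) ^ 2 := by positivity
      linarith
    have h6 : ε / 2 * (∑ e ∈ s, d e) ^ 4 ≤ ε / 2 * ((p : ℝ) ^ 6 * ∑ e ∈ s, (y e ^ 8 + 1)) := by
      gcongr
    have h7 : ε⁻¹ / 2 ≤ ε⁻¹ / 2 * ∑ e ∈ s, (if τ / 2 ≤ |y e - S e.1 e.2| then (1 : ℝ) else 0) :=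
      le_mul_of_one_le_right (by positivity) hone
    linarith

/-- Expectation of the deterministic bound: the moment bounds for the empirical covariance control
the linear term and the fourth moment of the error, and a union bound over the `p ^ 2` entries
controls the last term. -/
lemma integral_sq_quadEstimator_sub_le {n p : ℕ} {q R τ ε : ℝ} (hn : 0 < n) (hq0 : 0 ≤ q)
    (hq2 : q < 2) (hτ : 0 < τ) (hτ1 : τ ≤ 1)
    (hR : 0 ≤ R) (hε : 0 < ε) {S : Matrix (Fin p) (Fin p) ℝ} (hS : S ∈ sparseCorrClass p q R)
    {Ω : Type*} [MeasurableSpace Ω] {P : Measure Ω} [IsProbabilityMeasure P]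
    {X : Fin n → Ω → EuclideanSpace ℝ (Fin p)} (hX : IsGaussianSample P S X) :
    Integrable (fun ω ↦ (quadEstimator τ (fun k ↦ X k ω) - offDiagQuad S) ^ 2) P ∧
      ∫ ω, (quadEstimator τ (fun k ↦ X k ω) - offDiagQuad S) ^ 2 ∂P ≤
        162 * (R * τ ^ (2 - q)) ^ 2 + 8 * (R * max 1 (τ ^ (1 - q))) ^ 2 * (gaussMoment 4 / n) +
        ε / 2 * ((p : ℝ) ^ 8 * (gaussMoment 16 + 1)) +
        ε⁻¹ / 2 * ((p : ℝ) ^ 2 * (2 * Real.exp (-(n * (τ / 2) ^ 2 / 12)))) := by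
  obtain ⟨hpsd, hdiag, hSR⟩ := hS
  rw [sum_ite_ne_eq_sum_offDiag fun i j ↦ absPow q (S i j)] at hSR
  have hS1 := abs_le_one_of_posSemidef hpsd hdiag
  set s := (Finset.univ : Finset (Fin p)).offDiag
  set W := max 1 (τ ^ (1 - q))
  have hW0 : 0 ≤ W := zero_le_one.trans (le_max_left _ _)
  set a : Fin p × Fin p → ℝ := fun e ↦ if 2 * τ < |S e.1 e.2| then 2 * S e.1 e.2 else 0
  have hcard : (s.card : ℝ) ≤ (p : ℝ) ^ 2 := card_offDiag_univ_le p
  have hmeasD : AEMeasurable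
      (fun ω ↦ (quadEstimator τ (fun k ↦ X k ω) - offDiagQuad S) ^ 2) P :=
    (((measurable_quadEstimator τ).comp_aemeasurable
      (aemeasurable_pi_lambda _ fun k ↦ (hX.2 k).aemeasurable)).sub_const _).pow_const 2
  -- The three random terms of the deterministic bound are integrable.
  have hA := fun e : Fin p × Fin p ↦ hX.integrable_empCov_sub_sq hn hpsd hdiag e.1 e.2
  have hB := fun e : Fin p × Fin p ↦ hX.integrable_empCov_pow_eight hn hpsd hdiag e.1 e.2
  have hB1 : ∀ e : Fin p × Fin p, Integrable (fun ω ↦ empCov (fun k ↦ X k ω) e.1 e.2 ^ 8 + 1) P :=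
    fun e ↦ (hB e).1.add (integrable_const 1)
  have hC : ∀ e : Fin p × Fin p,
      Integrable (fun ω ↦ if τ / 2 ≤ |empCov (fun k ↦ X k ω) e.1 e.2 - S e.1 e.2| then (1 : ℝ)
        else 0) P ∧
      ∫ ω, (if τ / 2 ≤ |empCov (fun k ↦ X k ω) e.1 e.2 - S e.1 e.2| then (1 : ℝ) else 0) ∂P ≤
        2 * Real.exp (-(n * (τ / 2) ^ 2 / 12)) := fun e ↦ by
    have hset : NullMeasurableSet {ω | τ / 2 ≤ |empCov (fun k ↦ X k ω) e.1 e.2 - S e.1 e.2|} P :=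
      nullMeasurableSet_le aemeasurable_const
        ((hX.aemeasurable_empCov e.1 e.2).sub_const _).abs
    have hfun : (fun ω ↦ if τ / 2 ≤ |empCov (fun k ↦ X k ω) e.1 e.2 - S e.1 e.2| then (1 : ℝ)
        else 0) = {ω | τ / 2 ≤ |empCov (fun k ↦ X k ω) e.1 e.2 - S e.1 e.2|}.indicator
          fun _ ↦ 1 := by
      ext ω; simp [Set.indicator_apply]
    rw [hfun]
    refine ⟨(integrable_const 1).indicator₀ hset, ?_⟩
    rw [integral_indicator₀ hset]
    simp only [integral_const, measureReal_restrict_apply_univ, smul_eq_mul, mul_one]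
    exact hX.measureReal_le_abs_empCov_sub_le hn hpsd hdiag e.1 e.2 (by linarith) (by linarith)
  have hA' : Integrable (fun ω ↦ 4 * (R * W) *
      ∑ e ∈ s, |a e| * (empCov (fun k ↦ X k ω) e.1 e.2 - S e.1 e.2) ^ 2) P :=
    (integrable_finsetSum _ fun e _ ↦ (hA e).1.const_mul _).const_mul _
  have hB' : Integrable (fun ω ↦ ε / 2 * ((p : ℝ) ^ 6 *
      ∑ e ∈ s, (empCov (fun k ↦ X k ω) e.1 e.2 ^ 8 + 1))) P :=
    ((integrable_finsetSum _ fun e _ ↦ hB1 e).const_mul _).const_mul _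
  have hC' : Integrable (fun ω ↦ ε⁻¹ / 2 * ∑ e ∈ s,
      if τ / 2 ≤ |empCov (fun k ↦ X k ω) e.1 e.2 - S e.1 e.2| then (1 : ℝ) else 0) P :=
    (integrable_finsetSum _ fun e _ ↦ (hC e).1).const_mul _
  have h0 : Integrable (fun _ : Ω ↦ 162 * (R * τ ^ (2 - q)) ^ 2) P := integrable_const _
  have hpt := fun ω ↦ sq_quadEstimator_sub_le hq0 hq2 hτ hR hε hS1 hSR fun k ↦ X k ω
  have hint := ((h0.add hA').add hB').add hC'
  constructor
  · refine hint.mono' hmeasD.aestronglyMeasurable (ae_of_all _ fun ω ↦ ?_)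
    rw [Real.norm_of_nonneg (sq_nonneg _)]
    exact hpt ω
  · refine (integral_mono_of_nonneg (ae_of_all _ fun ω ↦ sq_nonneg _) hint
      (ae_of_all _ hpt)).trans ?_
    rw [integral_add' ((h0.add hA').add hB') hC', integral_add' (h0.add hA') hB',
      integral_add' h0 hA', integral_const_mul (4 * (R * W)), integral_const_mul (ε / 2),
      integral_const_mul ((p : ℝ) ^ 6), integral_const_mul (ε⁻¹ / 2),
      integral_finsetSum _ fun e _ ↦ (hA e).1.const_mul _,
      integral_finsetSum _ fun e _ ↦ hB1 e,
      integral_finsetSum _ fun e _ ↦ (hC e).1]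
    have hg4 := gaussMoment_nonneg (m := 4) (by decide)
    have hg16 := gaussMoment_nonneg (m := 16) (by decide)
    gcongr ?_ + ?_ + ε / 2 * ?_ + ε⁻¹ / 2 * ?_
    · simp
    · calc _ ≤ 4 * (R * W) * ∑ e ∈ s, |a e| * (gaussMoment 4 / n) := by
            gcongr with e
            rw [integral_const_mul]
            gcongr
            exact (hA e).2
        _ = 4 * (R * W) * ((∑ e ∈ s, |a e|) * (gaussMoment 4 / n)) := by rw [Finset.sum_mul]
        _ ≤ 4 * (R * W) * (2 * (R * W) * (gaussMoment 4 / n)) := by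
            gcongr
            exact sum_abs_linear_coeff_le hτ hS1 hSR
        _ = _ := by ring
    · calc _ ≤ (p : ℝ) ^ 6 * ∑ e ∈ s, (gaussMoment 16 + 1) := by
            gcongr with e
            rw [integral_add (hB e).1 (integrable_const 1)]
            simpa using (hB e).2
        _ = (p : ℝ) ^ 6 * (s.card * (gaussMoment 16 + 1)) := by
            rw [Finset.sum_const, nsmul_eq_mul]
        _ ≤ (p : ℝ) ^ 6 * ((p : ℝ) ^ 2 * (gaussMoment 16 + 1)) := by gcongr
        _ = _ := by ring
    · calc _ ≤ ∑ e ∈ s, 2 * Real.exp (-(n * (τ / 2) ^ 2 / 12)) :=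
            Finset.sum_le_sum fun e _ ↦ (hC e).2
        _ = s.card * (2 * Real.exp (-(n * (τ / 2) ^ 2 / 12))) := by simp
        _ ≤ _ := by gcongr

/-! ### Comparison with the rate -/

lemma threshold_sq {C₀ γ : ℝ} {n p : ℕ} (hγ : 0 ≤ γ) :
    threshold C₀ γ n p ^ 2 = 4 * C₀ ^ 2 * γ * (Real.log p / n) := by
  have hp : 0 ≤ Real.log p := Real.log_natCast_nonneg p
  rw [threshold, mul_pow, Real.sq_sqrt (by positivity)]
  ring

/-- For `2 ≤ p` the constant in front of the linear term costs no more than the rate. When `1 < q`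
this uses `1 / n ≤ τ ^ 2`, which needs `log p` bounded below. -/
lemma max_sq_div_le {q τ T m ℓ : ℝ} (hτ : 0 < τ) (hm : 0 < m) (hT : 2 ≤ T)
    (hℓ : 1 / 2 ≤ ℓ) (hτT : τ ^ 2 = T * (ℓ / m)) :
    (max 1 (τ ^ (1 - q))) ^ 2 / m ≤ 1 / m + (τ ^ (2 - q)) ^ 2 := by
  rcases max_choice 1 (τ ^ (1 - q)) with h | h <;> rw [h]
  · have : 0 ≤ (τ ^ (2 - q)) ^ 2 := by positivity
    rw [one_pow]; linarith
  · have h1 : 1 / m ≤ τ ^ 2 := by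
      rw [hτT, ← mul_div_assoc]
      gcongr
      nlinarith
    have h2 : τ ^ (2 - q) = τ ^ (1 - q) * τ := by
      rw [← Real.rpow_add_one hτ.ne']; ring_nf
    have h3 : 0 ≤ 1 / m := by positivity
    calc (τ ^ (1 - q)) ^ 2 / m = (τ ^ (1 - q)) ^ 2 * (1 / m) := by ring
      _ ≤ (τ ^ (1 - q)) ^ 2 * τ ^ 2 := by gcongr
      _ = (τ ^ (2 - q)) ^ 2 := by rw [h2]; ring
      _ ≤ _ := by linarith

end SparseQuad

theorem theorem3p1 (γ C₀ q : ℝ) (hγ : 8 < γ) (hC₀ : 4 ≤ C₀) (hq0 : 0 ≤ q) (hq2 : q < 2) :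
    ∃ C₁ : ℝ, 0 < C₁ ∧ ∃ C₂ : ℝ, 0 < C₂ ∧
      ∀ n p : ℕ, 1 ≤ p → γ * Real.log p < n → SparseQuad.threshold C₀ γ n p ≤ 1 →
      ∀ R : ℝ, 0 < R → ∀ S ∈ SparseQuad.sparseCorrClass p q R,
      ∀ {Ω : Type*} [MeasurableSpace Ω] (P : MeasureTheory.Measure Ω)
        [MeasureTheory.IsProbabilityMeasure P]
        (X : Fin n → Ω → EuclideanSpace ℝ (Fin p)), SparseQuad.IsGaussianSample P S X →
      MeasureTheory.Integrable
          (fun ω => (SparseQuad.quadEstimator (SparseQuad.threshold C₀ γ n p) (fun k => X k ω)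
            - SparseQuad.offDiagQuad S) ^ 2) P ∧
        ∫ ω, (SparseQuad.quadEstimator (SparseQuad.threshold C₀ γ n p) (fun k => X k ω)
            - SparseQuad.offDiagQuad S) ^ 2 ∂P
          ≤ C₁ * SparseQuad.rate n p q R + C₂ * (p : ℝ) ^ (4 - γ / 2) := by
  have hg4 := SparseQuad.gaussMoment_nonneg (m := 4) (by decide)
  have hg16 := SparseQuad.gaussMoment_nonneg (m := 16) (by decide)
  set T : ℝ := 4 * C₀ ^ 2 * γ with hT
  have hC₀sq : 16 ≤ C₀ ^ 2 := by nlinarith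
  have hT2 : 2 ≤ T := by nlinarith
  have hTq : 0 < T ^ (2 - q) := by positivity
  refine ⟨162 * T ^ (2 - q) + 8 * SparseQuad.gaussMoment 4 * (1 + T ^ (2 - q)), by positivity,
    (SparseQuad.gaussMoment 16 + 1) / 2 + 1, by positivity, ?_⟩
  intro n p hp hn hτ1 R hR S hS Ω _ P _ X hX
  have hrate : 0 ≤ SparseQuad.rate n p q R :=
    le_max_of_le_left (by positivity)
  rcases hp.eq_or_lt with rfl | hp2
  · -- There are no off-diagonal entries, and both functionals vanish.
    have h1 : SparseQuad.offDiagQuad S = 0 := by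
      simp [SparseQuad.offDiagQuad_eq, Finset.univ_unique]
    have h2 : ∀ x : Fin n → EuclideanSpace ℝ (Fin 1),
        SparseQuad.quadEstimator (SparseQuad.threshold C₀ γ n 1) x = 0 := fun x ↦ by
      simp [SparseQuad.quadEstimator_eq, Finset.univ_unique]
    simp only [h1, h2, sub_zero, ne_eq, OfNat.ofNat_ne_zero, not_false_eq_true, zero_pow,
      MeasureTheory.integral_zero]
    exact ⟨MeasureTheory.integrable_zero _ _ _, by positivity⟩
  have hp2' : (2 : ℝ) ≤ p := by exact_mod_cast hp2
  have hp0 : (0 : ℝ) < p := by linarith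
  have hlog : 1 / 2 ≤ Real.log p := by
    have := Real.log_le_log (by norm_num) hp2'
    linarith [Real.log_two_gt_d9]
  have hn0 : (0 : ℝ) < n := lt_of_le_of_lt (by positivity) hn
  have hn1 : 0 < n := by exact_mod_cast hn0
  set τ := SparseQuad.threshold C₀ γ n p with hτdef
  have hτsq : τ ^ 2 = T * (Real.log p / n) := SparseQuad.threshold_sq (by linarith)
  have hτ0 : 0 < τ := by
    rw [hτdef, SparseQuad.threshold]; positivity
  -- This weight balances the fourth moment against the probability of a large deviation.
  set ε : ℝ := (p : ℝ) ^ (-(4 + γ / 2)) with hε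
  obtain ⟨hint, hle⟩ := SparseQuad.integral_sq_quadEstimator_sub_le hn1 hq0 hq2 hτ0 hτ1 hR.le
    (ε := ε) (by positivity) hS hX
  refine ⟨hint, hle.trans ?_⟩
  have hpow : (τ ^ (2 - q)) ^ 2 = T ^ (2 - q) * (Real.log p / n) ^ (2 - q) := by
    rw [← Real.mul_rpow (by positivity) (by positivity), ← hτsq, ← Real.rpow_natCast,
      ← Real.rpow_natCast, ← Real.rpow_mul hτ0.le, ← Real.rpow_mul hτ0.le, mul_comm]
  have hb1 : R ^ 2 / n ≤ SparseQuad.rate n p q R := le_max_left _ _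
  have hb2 : R ^ 2 * (τ ^ (2 - q)) ^ 2 ≤ T ^ (2 - q) * SparseQuad.rate n p q R := by
    rw [hpow]
    calc _ = T ^ (2 - q) * (R ^ 2 * (Real.log p / n) ^ (2 - q)) := by ring
      _ ≤ _ := by gcongr; exact le_max_right _ _
  have hb3 : R ^ 2 * ((max 1 (τ ^ (1 - q))) ^ 2 / n) ≤
      (1 + T ^ (2 - q)) * SparseQuad.rate n p q R := by
    calc _ ≤ R ^ 2 * (1 / n + (τ ^ (2 - q)) ^ 2) := by
          gcongr
          exact SparseQuad.max_sq_div_le hτ0 hn0 hT2 hlog hτsq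
      _ = R ^ 2 / n + R ^ 2 * (τ ^ (2 - q)) ^ 2 := by ring
      _ ≤ _ := by linarith
  have hexp : Real.exp (-(n * (τ / 2) ^ 2 / 12)) ≤ (p : ℝ) ^ (-(γ + 2)) := by
    rw [Real.rpow_def_of_pos hp0, div_pow, hτsq]
    apply Real.exp_le_exp.2
    have : (n : ℝ) * (T * (Real.log p / n) / 2 ^ 2) / 12 = Real.log p * (C₀ ^ 2 * γ / 12) := by
      rw [hT]; field_simp; ring
    rw [this]
    -- The two extra powers of `p` pay for the union bound over the entries.
    have : γ + 2 ≤ C₀ ^ 2 * γ / 12 := by nlinarith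
    nlinarith
  have hc1 : ε / 2 * ((p : ℝ) ^ 8 * (SparseQuad.gaussMoment 16 + 1)) =
      (SparseQuad.gaussMoment 16 + 1) / 2 * (p : ℝ) ^ (4 - γ / 2) := by
    have : ε * (p : ℝ) ^ 8 = (p : ℝ) ^ (4 - γ / 2) := by
      rw [hε, ← Real.rpow_natCast, ← Real.rpow_add hp0]; congr 1; push_cast; ring
    rw [← this]; ring
  have hc2 : ε⁻¹ / 2 * ((p : ℝ) ^ 2 * (2 * Real.exp (-(n * (τ / 2) ^ 2 / 12)))) ≤
      (p : ℝ) ^ (4 - γ / 2) := by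
    calc _ ≤ ε⁻¹ / 2 * ((p : ℝ) ^ 2 * (2 * (p : ℝ) ^ (-(γ + 2)))) := by gcongr
      _ = ε⁻¹ * (p : ℝ) ^ 2 * (p : ℝ) ^ (-(γ + 2)) := by ring
      _ = _ := by
        rw [hε, ← Real.rpow_neg hp0.le, ← Real.rpow_natCast, ← Real.rpow_add hp0,
          ← Real.rpow_add hp0]
        congr 1; push_cast; ring
  rw [hc1]
  calc _ = 162 * (R ^ 2 * (τ ^ (2 - q)) ^ 2) +
        8 * SparseQuad.gaussMoment 4 * (R ^ 2 * ((max 1 (τ ^ (1 - q))) ^ 2 / n)) +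
        (SparseQuad.gaussMoment 16 + 1) / 2 * (p : ℝ) ^ (4 - γ / 2) +
        ε⁻¹ / 2 * ((p : ℝ) ^ 2 * (2 * Real.exp (-(n * (τ / 2) ^ 2 / 12)))) := by ring
    _ ≤ 162 * (T ^ (2 - q) * SparseQuad.rate n p q R) +
        8 * SparseQuad.gaussMoment 4 * ((1 + T ^ (2 - q)) * SparseQuad.rate n p q R) +
        (SparseQuad.gaussMoment 16 + 1) / 2 * (p : ℝ) ^ (4 - γ / 2) +
        (p : ℝ) ^ (4 - γ / 2) := by gcongr
    _ = _ := by ring
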